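/- Let $d\ge 1$ and $P\in L^\infty(\mathbf R^d;\mathbf R)$, and let $S(t)=e^{-itP(D)}$, $D=-i\nabla_x$, be the associated unitary group, i.e. $S(t)u_0$ is obtained from $u_0$ by multiplying its Fourier transform by $e^{-itP(\xi)}$. Call a pair $(p,q)\neq(2,\infty)$ of exponents in $[2,\infty]^2$ admissible if $$\frac{2}{p}=d\left(\frac12-\frac1q\right)$$ (with $1/\infty=0$). Suppose that there exist an admissible pair $(p,q)$, an index $k\in\mathbf R$, a time interval $I\ni 0$ with $|I|>0$, and a constant $C>0$ such that $$\|S(\cdot)u_0\|_{L^p(I;L^q(\mathbf R^d))}\le C\|u_0\|_{H^k(\mathbf R^d)}\qquad\text{for all } u_0\in H^k(\mathbf R^d).$$ Then necessarily $k\ge \dfrac{2}{p}=\dfrac d2-\dfrac dq$. -/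

import Mathlib

open MeasureTheory FourierTransform TemperedDistribution
open scoped ENNReal SchwartzMap

noncomputable section

namespace ModifiedDispersion

/-- A pair of exponents `(p, q) ≠ (2, ∞)` in `[2, ∞]²` is admissible in dimension `d` if
`2 / p = d (1 / 2 - 1 / q)`, where `1 / ∞ = 0`. -/
structure IsAdmissible (d : ℕ) (p q : ℝ≥0∞) : Prop where
  two_le_left : 2 ≤ p
  two_le_right : 2 ≤ q
  ne_endpoint : (p, q) ≠ (2, ∞)
  scaling : 2 * (p⁻¹).toReal = d * (1 / 2 - (q⁻¹).toReal)

/-- The Sobolev space `H^k(ℝ^d)`, `k ∈ ℝ`, as a subspace of the tempered distributions. -/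
def SobolevH (d : ℕ) (k : ℝ) : Submodule ℂ 𝓢'(EuclideanSpace ℝ (Fin d), ℂ) where
  carrier := {u | MemSobolev k 2 u}
  add_mem' hu hv := hu.add hv
  zero_mem' := memSobolev_fun_zero _ _ k 2
  smul_mem' c _ hu := hu.smul c

/-- The (unique) `L²` function representing `J^k u` for `u ∈ H^k(ℝ^d)`, where `J^k` is the Bessel
potential operator of order `k`. -/
def besselL2 {d : ℕ} {k : ℝ} (u : SobolevH d k) :
    Lp ℂ 2 (volume : Measure (EuclideanSpace ℝ (Fin d))) :=
  Exists.choose (show MemSobolev k 2 (u : 𝓢'(EuclideanSpace ℝ (Fin d), ℂ)) from u.2)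

/-- The norm `‖u‖_{H^k} = ‖J^k u‖_{L²}`. With Mathlib's normalization `e^{-2πi x·ξ}` of the Fourier
transform, `J^k = (1 - Δ / (4π²))^{k/2}`; the norm is equivalent to the one given by
`(1 - Δ)^{k/2}`. -/
def sobolevNorm {d : ℕ} {k : ℝ} (u : SobolevH d k) : ℝ := ‖besselL2 u‖

/-- The symbol `ξ ↦ e^{-itP(2πξ)}` of `e^{-itP(D)}`, `D = -i∇`: with Mathlib's normalization
`e^{-2πi x·ξ}` of the Fourier transform, `D` is multiplication by `2πξ` on the Fourier side. -/
def phase {d : ℕ} (P : Lp ℝ ∞ (volume : Measure (EuclideanSpace ℝ (Fin d)))) (t : ℝ)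
    (ξ : EuclideanSpace ℝ (Fin d)) : ℂ :=
  Complex.exp (-(Complex.I * t * (P ((2 * Real.pi) • ξ) : ℝ)))

theorem phase_memLp {d : ℕ} (P : Lp ℝ ∞ (volume : Measure (EuclideanSpace ℝ (Fin d)))) (t : ℝ) :
    MemLp (phase P t) ∞ volume := by
  have hm : Measurable (phase P t) := by
    have h1 : Measurable fun ξ : EuclideanSpace ℝ (Fin d) ↦ P ((2 * Real.pi) • ξ) :=
      (Lp.stronglyMeasurable P).measurable.comp (measurable_const_smul _)
    unfold phase
    fun_prop
  refine memLp_top_of_bound hm.aestronglyMeasurable 1 (Filter.Eventually.of_forall fun ξ ↦ ?_)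
  simp [phase, Complex.norm_exp]

/-- The unitary operator `e^{-itP(D)}` on `L²(ℝ^d)`: multiplication by its symbol on the Fourier
side. -/
def groupL2 {d : ℕ} (P : Lp ℝ ∞ (volume : Measure (EuclideanSpace ℝ (Fin d)))) (t : ℝ)
    (f : Lp ℂ 2 (volume : Measure (EuclideanSpace ℝ (Fin d)))) :
    Lp ℂ 2 (volume : Measure (EuclideanSpace ℝ (Fin d))) :=
  𝓕⁻ ((phase_memLp P t).toLp (phase P t) • 𝓕 f :
    Lp ℂ 2 (volume : Measure (EuclideanSpace ℝ (Fin d))))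

/-- The free flow `S(t) u = e^{-itP(D)} u` of `u ∈ H^k(ℝ^d)`. Fourier multipliers commute, so it is
`J^{-k} e^{-itP(D)} J^k u` with `J^k u ∈ L²`; on the Fourier side this is multiplication of `û` by
the symbol of `e^{-itP(D)}`. -/
def freeFlow {d : ℕ} {k : ℝ} (P : Lp ℝ ∞ (volume : Measure (EuclideanSpace ℝ (Fin d)))) (t : ℝ)
    (u : SobolevH d k) : 𝓢'(EuclideanSpace ℝ (Fin d), ℂ) :=
  besselPotential (EuclideanSpace ℝ (Fin d)) ℂ (-k)
    (groupL2 P t (besselL2 u) : 𝓢'(EuclideanSpace ℝ (Fin d), ℂ))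

/-- The `L^q` norm of a tempered distribution: the `L^q` norm of the `L^q` function (unique up to
null sets) that represents it, and `∞` if there is no such function. -/
def lqNorm {d : ℕ} (q : ℝ≥0∞) (u : 𝓢'(EuclideanSpace ℝ (Fin d), ℂ)) : ℝ≥0∞ :=
  ⨅ (g : EuclideanSpace ℝ (Fin d) → ℂ)
    (_ : MemLp g q volume ∧ ∀ φ : 𝓢(EuclideanSpace ℝ (Fin d), ℂ), u φ = ∫ x, φ x * g x),
    eLpNorm g q volume

/-- The `L^p(I; L^q(ℝ^d))` norm of a distribution-valued function of time. -/
def strichartzNorm {d : ℕ} (p q : ℝ≥0∞) (I : Set ℝ)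
    (v : ℝ → 𝓢'(EuclideanSpace ℝ (Fin d), ℂ)) : ℝ≥0∞ :=
  eLpNorm (fun t ↦ lqNorm q (v t)) p (volume.restrict I)

end ModifiedDispersion

end

/-! Since `P` is bounded, `e^{-itP}` stays close to 1 for `|t| ≤ 1/‖P‖`: no dispersion occurs on a
short time interval, and the estimate can do no better than the Sobolev embedding `H^k ⊂ L^q`, which
forces `k ≥ d/2 - d/q`. Scaling makes this precise. Take `J^k u = 𝓕⁻ (χ(·/l))` with `χ` supported in
an annulus, so `‖u‖_{H^k}` is of order `l^{d/2}`. Pairing `S(t)u` with `𝓕 (χ(·/l))` gives at least a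
multiple of `l^{d-k}` (`le_norm_freeFlow_fourier_dilate`), while the test function has dual norm of
order `l^{d/q}`. Hölder then bounds the `L^q` norm below by a multiple of `l^{d-k-d/q}` throughout a
set of times of positive measure independent of `l`. Hence `l^{d/2-d/q-k}` is bounded for `l ≥ 1`.
-/

namespace ModifiedDispersion

/-! ### Scaling of Fourier transforms and Lebesgue norms -/

section Dilation

variable {E : Type*} [NormedAddCommGroup E] [InnerProductSpace ℝ E]

/-- The dilate `x ↦ f (l⁻¹ x)` of a Schwartz function. -/
noncomputable def dilate {l : ℝ} (hl : 0 < l) (f : 𝓢(E, ℂ)) : 𝓢(E, ℂ) :=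
  SchwartzMap.compCLMOfContinuousLinearEquiv ℂ
    (ContinuousLinearEquiv.smulLeft (Units.mk0 l⁻¹ (inv_ne_zero hl.ne'))) f

theorem dilate_apply {l : ℝ} (hl : 0 < l) (f : 𝓢(E, ℂ)) (x : E) :
    dilate hl f x = f (l⁻¹ • x) := rfl

variable [FiniteDimensional ℝ E] [MeasurableSpace E] [BorelSpace E]

/-- The Fourier transform of a dilate. -/
theorem fourier_dilate_apply {l : ℝ} (hl : 0 < l) (f : 𝓢(E, ℂ)) (x : E) :
    𝓕 (dilate hl f) x = ((l ^ Module.finrank ℝ E : ℝ) : ℂ) • 𝓕 f (l • x) := by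
  have h := Measure.integral_comp_inv_smul (volume : Measure E)
    (fun v ↦ Complex.exp (↑(-2 * Real.pi * inner ℝ v (l • x)) * Complex.I) • f v) l
  rw [abs_of_pos (by positivity)] at h
  simp only [SchwartzMap.fourier_coe, Real.fourier_eq']
  rw [Complex.coe_smul, ← h]
  refine integral_congr_ae (.of_forall fun v ↦ ?_)
  simp only [dilate_apply, inner_smul_left, inner_smul_right]
  congr 4
  have := hl.ne'
  simp
  field_simp

/-- The behaviour of the `L^r` norm under dilations. -/
theorem eLpNorm_comp_smul {l : ℝ} (hl : 0 < l) {r : ℝ≥0∞} (hr : r ≠ ∞) (f : E → ℂ) :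
    eLpNorm (fun x ↦ f (l • x)) r volume =
      ENNReal.ofReal (l ^ (-(Module.finrank ℝ E * (r⁻¹).toReal) : ℝ)) * eLpNorm f r volume := by
  have hme : MeasurableEmbedding (fun x : E ↦ l • x) :=
    (Homeomorph.smulOfNeZero l hl.ne').measurableEmbedding
  have h := hme.eLpNorm_map_measure (μ := volume) (p := r) (g := f)
  rw [Measure.map_addHaar_smul _ hl.ne', eLpNorm_smul_measure_of_ne_top hr, smul_eq_mul] at h
  change eLpNorm (f ∘ fun x ↦ l • x) r volume = _
  rw [← h, abs_of_pos (by positivity), ENNReal.ofReal_rpow_of_pos (by positivity), one_div,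
    Real.rpow_neg hl.le, Real.rpow_mul hl.le, Real.rpow_natCast,
    Real.inv_rpow (by positivity)]

end Dilation

/-! ### A frequency-localized profile -/

section Bump

variable {E : Type*} [NormedAddCommGroup E] [InnerProductSpace ℝ E] [FiniteDimensional ℝ E]
  [MeasurableSpace E] [BorelSpace E]

/-- A nonzero real-valued Schwartz function supported in the annulus `1 ≤ |x| ≤ 3`. -/
theorem exists_schwartz_annulus {e : E} (he : ‖e‖ = 2) : ∃ χ : 𝓢(E, ℂ), ∃ f : E → ℝ,
    (∀ x, χ x = f x) ∧ (∀ x, f x ≠ 0 → 1 ≤ ‖x‖ ∧ ‖x‖ ≤ 3) ∧ 0 < ∫ x, f x ^ 2 := by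
  -- Outer radius 1 about a point of norm 2 keeps the support in the annulus.
  obtain ⟨f, hr⟩ : ∃ f : ContDiffBump e, f.rOut = 1 :=
    ⟨⟨1 / 2, 1, by norm_num, by norm_num⟩, rfl⟩
  have hsupp : HasCompactSupport (fun x ↦ (f x : ℂ)) :=
    f.hasCompactSupport.comp_left (g := fun y : ℝ ↦ (y : ℂ)) Complex.ofReal_zero
  have hsmooth : ContDiff ℝ (⊤ : ℕ∞) (fun x ↦ (f x : ℂ)) :=
    Complex.ofRealCLM.contDiff.comp f.contDiff
  refine ⟨hsupp.toSchwartzMap hsmooth, f, fun x ↦ by simp, fun x hx ↦ ?_, ?_⟩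
  · have hx' : x ∈ Metric.ball e f.rOut := by rwa [← f.support_eq]
    rw [hr, mem_ball_iff_norm] at hx'
    have h1 := norm_le_norm_add_norm_sub' x e
    have h2 := norm_le_norm_add_norm_sub' e x
    rw [norm_sub_rev e x] at h2
    constructor <;> linarith
  · have hc : Continuous (fun x ↦ f x ^ 2) := f.continuous.pow 2
    refine hc.integral_pos_of_hasCompactSupport_nonneg_nonzero
      (f.hasCompactSupport.comp_left (g := fun y : ℝ ↦ y ^ 2) (by simp))
      (fun x ↦ sq_nonneg _) (x := e) ?_
    rw [f.one_of_mem_closedBall (Metric.mem_closedBall_self f.rIn_pos.le)]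
    norm_num

end Bump

/-! ### Duality and the lower bound at frequency `l` -/

section Pairing

variable {d : ℕ}

local notation "𝔼" => EuclideanSpace ℝ (Fin d)

theorem toTemperedDistribution_injective :
    Function.Injective (fun f : Lp ℂ 2 (volume : Measure 𝔼) ↦ (f : 𝓢'(𝔼, ℂ))) :=
  LinearMap.ker_eq_bot.mp (Lp.ker_toTemperedDistributionCLM_eq_bot (E := 𝔼) (F := ℂ) (p := 2)
    (μ := volume))

/-- Every `L²` function is the Bessel potential `J^k u` of some `u ∈ H^k`. -/
theorem exists_besselL2_eq (k : ℝ) (f : Lp ℂ 2 (volume : Measure 𝔼)) :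
    ∃ u : SobolevH d k, besselL2 u = f := by
  have hu : besselPotential 𝔼 ℂ k (besselPotential 𝔼 ℂ (-k) (f : 𝓢'(𝔼, ℂ))) = f := by simp
  -- `besselL2` is a chosen representative, so it is identified with `f` through injectivity.
  refine ⟨⟨besselPotential 𝔼 ℂ (-k) f, f, hu⟩, toTemperedDistribution_injective ?_⟩
  have h := Exists.choose_spec (show MemSobolev k 2 (besselPotential 𝔼 ℂ (-k) (f : 𝓢'(𝔼, ℂ)))
    from ⟨f, hu⟩)
  exact h.symm.trans hu

/-- The free flow, tested on the Fourier side. -/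
theorem freeFlow_fourier_apply (P : Lp ℝ ∞ (volume : Measure 𝔼)) (t k : ℝ) (χ ψ : 𝓢(𝔼, ℂ))
    (u : SobolevH d k) (hu : besselL2 u = (𝓕⁻ χ).toLp 2) :
    freeFlow P t u (𝓕 ψ) =
      ∫ x, (((1 + ‖x‖ ^ 2) ^ (-k / 2) : ℝ) * ψ x) * (phase P t x * χ x) := by
  rw [← TemperedDistribution.fourier_apply, freeFlow,
    fourier_besselPotential_eq_smulLeftCLM_fourier_apply, smulLeftCLM_apply_apply,
    Lp.fourier_toTemperedDistribution_eq, groupL2, fourier_fourierInv_eq, hu,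
    ← SchwartzMap.toLp_fourierInv_eq, fourier_fourierInv_eq, Lp.toTemperedDistribution_apply]
  refine integral_congr_ae ?_
  filter_upwards [Lp.coeFn_lpSMul (r := 2) ((phase_memLp P t).toLp (phase P t)) (χ.toLp 2),
    (phase_memLp P t).coeFn_toLp, χ.coeFn_toLp 2 volume] with x h1 h2 h3
  rw [h1, Pi.smul_apply', h2, h3, SchwartzMap.smulLeftCLM_apply_apply (by fun_prop)]
  rfl

/-- The real part is `cos (tP)`, and `cos y ≥ 1 - y²/2 ≥ 1/2` for `|y| ≤ 1`; this rules out
cancellation in the pairing. -/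
theorem ae_half_le_re_phase (P : Lp ℝ ∞ (volume : Measure 𝔼)) {t : ℝ} (ht : |t| * ‖P‖ ≤ 1) :
    ∀ᵐ x, 1 / 2 ≤ (phase P t x).re := by
  have h1 : ∀ᵐ x, ‖P x‖ ≤ ‖P‖ := by
    have := enorm_ae_le_eLpNormEssSup P (volume : Measure 𝔼)
    filter_upwards [this] with x hx
    rw [← eLpNorm_exponent_top, ← Lp.enorm_def] at hx
    simpa using ENNReal.toReal_mono (by simp) hx
  -- Dilation by `2π` pulls null sets back to null sets, so the a.e. bound on `P` transfers.
  filter_upwards [(Measure.quasiMeasurePreserving_smul (volume : Measure 𝔼)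
    (r := 2 * Real.pi) (by positivity)).ae h1] with x hx
  have h2 : (phase P t x).re = Real.cos (t * P ((2 * Real.pi) • x)) := by
    have : -(Complex.I * t * (P ((2 * Real.pi) • x) : ℝ)) =
        ((-(t * P ((2 * Real.pi) • x)) : ℝ) : ℂ) * Complex.I := by push_cast; ring
    rw [phase, this, Complex.exp_ofReal_mul_I_re, Real.cos_neg]
  have h3 : |t * P ((2 * Real.pi) • x)| ≤ 1 := by
    rw [abs_mul]
    exact (mul_le_mul_of_nonneg_left hx (abs_nonneg t)).trans ht
  have h4 := Real.one_sub_sq_div_two_le_cos (x := t * P ((2 * Real.pi) • x))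
  have h5 := (sq_le_one_iff_abs_le_one _).mpr h3
  rw [h2]
  linarith

/-- Hölder's inequality as a lower bound of `lqNorm`. -/
theorem enorm_apply_div_le_lqNorm {q r : ℝ≥0∞} [r.HolderConjugate q] (u : 𝓢'(𝔼, ℂ))
    (φ : 𝓢(𝔼, ℂ)) {b : ℝ≥0∞} (hb : eLpNorm φ r volume ≤ b) (hb0 : b ≠ 0) (hb' : b ≠ ∞) :
    ‖u φ‖ₑ / b ≤ lqNorm q u := by
  refine le_iInf₂ fun g hg ↦ ?_
  rw [ENNReal.div_le_iff hb0 hb', hg.2 φ, mul_comm]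
  calc ‖∫ x, φ x * g x‖ₑ ≤ ∫⁻ x, ‖φ x * g x‖ₑ := enorm_integral_le_lintegral_enorm _
    _ = eLpNorm (⇑φ • g) 1 volume := by rw [eLpNorm_one_eq_lintegral_enorm]; rfl
    _ ≤ eLpNorm φ r volume * eLpNorm g q volume :=
      eLpNorm_smul_le_mul_eLpNorm hg.1.1 (φ.memLp r volume).1
    _ ≤ b * eLpNorm g q volume := by gcongr

/-- On the annulus `1 ≤ |x| ≤ 3`, the Bessel weight at frequency `l x` is at least of order
`l^{-k}`. -/
theorem exists_le_bessel_weight (k : ℝ) : ∃ c : ℝ, 0 < c ∧ ∀ l : ℝ, 1 ≤ l → ∀ x : 𝔼,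
    1 ≤ ‖x‖ → ‖x‖ ≤ 3 → c * l ^ (-k) ≤ (1 + ‖l • x‖ ^ 2) ^ (-k / 2) := by
  have hpow (l : ℝ) (hl : 1 ≤ l) : l ^ (-k) = (l ^ 2) ^ (-k / 2) := by
    rw [← Real.rpow_natCast_mul (by positivity)]
    congr 1
    push_cast
    ring
  have hnorm (l : ℝ) (hl : 1 ≤ l) (x : 𝔼) : ‖l • x‖ ^ 2 = l ^ 2 * ‖x‖ ^ 2 := by
    rw [norm_smul, mul_pow, Real.norm_of_nonneg (by positivity)]
  -- The sign of `-k/2` decides which bound is needed: `1 + l²|x|² ≤ 10 l²` or `l² ≤ 1 + l²|x|²`.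
  rcases le_total 0 k with hk | hk
  · refine ⟨10 ^ (-k / 2), by positivity, fun l hl x _ hx ↦ ?_⟩
    rw [hpow l hl, ← Real.mul_rpow (by positivity) (by positivity), hnorm l hl]
    refine Real.rpow_le_rpow_of_nonpos (by positivity) ?_ (by linarith)
    have h1 : 1 ≤ l ^ 2 := one_le_pow₀ hl
    have h2 : ‖x‖ ^ 2 ≤ 9 := by nlinarith [norm_nonneg x]
    nlinarith [mul_le_mul_of_nonneg_left h2 (sq_nonneg l)]
  · refine ⟨1, one_pos, fun l hl x hx _ ↦ ?_⟩
    rw [hpow l hl, one_mul, hnorm l hl]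
    refine Real.rpow_le_rpow (by positivity) ?_ (by linarith)
    have h2 : 1 ≤ ‖x‖ ^ 2 := one_le_pow₀ hx
    nlinarith [mul_le_mul_of_nonneg_left h2 (sq_nonneg l)]

/-- The lower bound of the pairing of the free flow, for data at frequency `l`. -/
theorem le_norm_freeFlow_fourier_dilate (P : Lp ℝ ∞ (volume : Measure 𝔼)) {t : ℝ}
    (ht : |t| * ‖P‖ ≤ 1) (k : ℝ) {χ : 𝓢(𝔼, ℂ)} {f : 𝔼 → ℝ} (hχ : ∀ x, χ x = f x)
    (hf : ∀ x, f x ≠ 0 → 1 ≤ ‖x‖ ∧ ‖x‖ ≤ 3) {c : ℝ} {l : ℝ} (hl : 0 < l)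
    (hc : ∀ x : 𝔼, 1 ≤ ‖x‖ → ‖x‖ ≤ 3 → c * l ^ (-k) ≤ (1 + ‖l • x‖ ^ 2) ^ (-k / 2))
    (u : SobolevH d k) (hu : besselL2 u = (𝓕⁻ (dilate hl χ)).toLp 2) :
    c / 2 * (∫ x, f x ^ 2) * l ^ (d - k) ≤ ‖freeFlow P t u (𝓕 (dilate hl χ))‖ := by
  have hfi : Integrable (fun x ↦ f x ^ 2) := by
    have h := ((χ.memLp 2 volume).integrable_norm_pow (by norm_num))
    refine h.congr (.of_forall fun x ↦ ?_)
    simp [hχ]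
  have hmain : ∀ᵐ x, c / 2 * l ^ (-k) * f (l⁻¹ • x) ^ 2 ≤
      ((((1 + ‖x‖ ^ 2) ^ (-k / 2) : ℝ) * dilate hl χ x) * (phase P t x * dilate hl χ x)).re := by
    filter_upwards [ae_half_le_re_phase P ht] with x hx
    have hre : ((((1 + ‖x‖ ^ 2) ^ (-k / 2) : ℝ) * dilate hl χ x) *
        (phase P t x * dilate hl χ x)).re =
        (1 + ‖x‖ ^ 2) ^ (-k / 2) * (phase P t x).re * f (l⁻¹ • x) ^ 2 := by
      have : (((1 + ‖x‖ ^ 2) ^ (-k / 2) : ℝ) * dilate hl χ x) * (phase P t x * dilate hl χ x) =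
          (((1 + ‖x‖ ^ 2) ^ (-k / 2) * f (l⁻¹ • x) ^ 2 : ℝ) : ℂ) * phase P t x := by
        rw [dilate_apply, hχ]
        push_cast
        ring
      rw [this, Complex.re_ofReal_mul]
      ring
    rw [hre]
    by_cases h0 : f (l⁻¹ • x) = 0
    · simp [h0]
    · obtain ⟨h1, h3⟩ := hf _ h0
      have h4 := hc _ h1 h3
      rw [smul_inv_smul₀ hl.ne'] at h4
      have hw : 0 ≤ (1 + ‖x‖ ^ 2) ^ (-k / 2) := by positivity
      refine mul_le_mul_of_nonneg_right ?_ (sq_nonneg _)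
      calc c / 2 * l ^ (-k) = c * l ^ (-k) * (1 / 2) := by ring
        _ ≤ (1 + ‖x‖ ^ 2) ^ (-k / 2) * (1 / 2) := by gcongr
        _ ≤ _ := by gcongr
  have hint : Integrable (fun x ↦ ((((1 + ‖x‖ ^ 2) ^ (-k / 2) : ℝ) : ℂ) * dilate hl χ x) *
      (phase P t x * dilate hl χ x)) := by
    have h1 : MemLp (fun x ↦ phase P t x * dilate hl χ x) 2 volume :=
      ((dilate hl χ).memLp 2 volume).mul (phase_memLp P t) (hpqr := inferInstance)
    have h2 : MemLp (fun x : 𝔼 ↦ (((1 + ‖x‖ ^ 2) ^ (-k / 2) : ℝ) : ℂ) * dilate hl χ x) 2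
        volume := by
      refine (memLp_congr_ae (.of_forall fun x ↦ ?_)).mp ((SchwartzMap.smulLeftCLM ℂ
        (fun x : 𝔼 ↦ (((1 + ‖x‖ ^ 2) ^ (-k / 2) : ℝ) : ℂ)) (dilate hl χ)).memLp 2 volume)
      exact SchwartzMap.smulLeftCLM_apply_apply (by fun_prop) _ x
    exact h2.integrable_mul h1
  rw [freeFlow_fourier_apply P t k _ _ u hu]
  calc c / 2 * (∫ x, f x ^ 2) * l ^ (d - k)
      = ∫ x, c / 2 * l ^ (-k) * f (l⁻¹ • x) ^ 2 := by
        rw [integral_const_mul, Measure.integral_comp_inv_smul volume (fun x ↦ f x ^ 2) l,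
          abs_of_pos (by positivity), finrank_euclideanSpace_fin, smul_eq_mul, sub_eq_add_neg,
          Real.rpow_add hl, Real.rpow_natCast]
        ring
    _ ≤ ∫ x, ((((1 + ‖x‖ ^ 2) ^ (-k / 2) : ℝ) * dilate hl χ x) *
          (phase P t x * dilate hl χ x)).re :=
        integral_mono_ae ((hfi.comp_smul (inv_ne_zero hl.ne')).const_mul _) hint.re hmain
    _ = (∫ x, (((1 + ‖x‖ ^ 2) ^ (-k / 2) : ℝ) * dilate hl χ x) *
          (phase P t x * dilate hl χ x)).re := integral_re hint
    _ ≤ _ := Complex.re_le_norm _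

end Pairing

/-! ### Time integration and the limit of high frequency -/

/-- A nondegenerate interval containing `0` meets each neighbourhood of `0` in a set of positive
measure. -/
theorem volume_inter_Icc_pos {I : Set ℝ} (hI : I.OrdConnected) (h0 : (0 : ℝ) ∈ I)
    (hIpos : 0 < volume I) {T : ℝ} (hT : 0 < T) : 0 < volume (I ∩ Set.Icc (-T) T) := by
  obtain ⟨a, ha, ha0⟩ : ∃ a ∈ I, a ≠ 0 := by
    by_contra! h
    have : volume I ≤ volume ({0} : Set ℝ) := measure_mono fun x hx ↦ h x hx
    simp at this
    exact hIpos.ne' this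
  rcases ha0.lt_or_gt with h | h
  · refine lt_of_lt_of_le ?_ (measure_mono (s := Set.Icc (max a (-T)) 0) fun x hx ↦
      ⟨hI.out ha h0 ⟨(le_max_left _ _).trans hx.1, hx.2⟩,
        (le_max_right _ _).trans hx.1, hx.2.trans hT.le⟩)
    simp [h, hT]
  · refine lt_of_lt_of_le ?_ (measure_mono (s := Set.Icc 0 (min a T)) fun x hx ↦
      ⟨hI.out h0 ha ⟨hx.1, hx.2.trans (min_le_left _ _)⟩,
        (neg_nonpos.mpr hT.le).trans hx.1, hx.2.trans (min_le_right _ _)⟩)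
    simp [h, hT]

/-- A lower bound on a subset of `I` gives a lower bound of the `L^p(I)` norm. -/
theorem mul_measure_rpow_le_eLpNorm {p : ℝ≥0∞} (hp : p ≠ 0) {I J : Set ℝ} (hJ : J ⊆ I)
    (hJm : MeasurableSet J) (hJ0 : volume J ≠ 0) {g : ℝ → ℝ≥0∞} {a : ℝ≥0∞}
    (h : ∀ t ∈ J, a ≤ g t) :
    a * volume J ^ (1 / p.toReal) ≤ eLpNorm g p (volume.restrict I) := by
  have hne : volume.restrict J ≠ 0 := by simpa [Measure.restrict_eq_zero]
  -- This includes `p = ∞`, where `1 / p.toReal = 1 / 0 = 0` and the factor is 1.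
  calc a * volume J ^ (1 / p.toReal) = eLpNorm (fun _ : ℝ ↦ a) p (volume.restrict J) := by
        rw [eLpNorm_const a hp hne]; simp
    _ ≤ eLpNorm g p (volume.restrict J) :=
        eLpNorm_mono_enorm_ae ((ae_restrict_iff' hJm).mpr
          (.of_forall fun t ht ↦ by simpa using h t ht))
    _ ≤ _ := eLpNorm_mono_measure _ (Measure.restrict_mono hJ le_rfl)

theorem exponent_le_zero_of_rpow_le {s a b : ℝ} (ha : 0 < a)
    (h : ∀ l : ℝ, 1 ≤ l → a * l ^ s ≤ b) : s ≤ 0 := by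
  by_contra! hs
  have h1 := (tendsto_rpow_atTop hs).const_mul_atTop ha
  obtain ⟨l, hl, hl'⟩ := ((h1.eventually_gt_atTop b).and (Filter.eventually_ge_atTop 1)).exists
  exact absurd (h l hl') (not_le.mpr hl)

end ModifiedDispersion

open ModifiedDispersion in
theorem corollary1 (d : ℕ) (hd : 1 ≤ d)
    (P : MeasureTheory.Lp ℝ ∞ (MeasureTheory.volume : Measure (EuclideanSpace ℝ (Fin d))))
    (p q : ℝ≥0∞) (hpq : ModifiedDispersion.IsAdmissible d p q) (k : ℝ)
    (I : Set ℝ) (hI : I.OrdConnected) (h0 : (0 : ℝ) ∈ I) (hIpos : 0 < volume I)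
    (C : ℝ) (hC : 0 < C)
    (hS : ∀ u₀ : ModifiedDispersion.SobolevH d k,
      ModifiedDispersion.strichartzNorm p q I (fun t ↦ ModifiedDispersion.freeFlow P t u₀) ≤
        ENNReal.ofReal (C * ModifiedDispersion.sobolevNorm u₀)) :
    2 * (p⁻¹).toReal ≤ k ∧ 2 * (p⁻¹).toReal = (d : ℝ) / 2 - d * (q⁻¹).toReal := by
  have hscal : 2 * (p⁻¹).toReal = (d : ℝ) / 2 - d * (q⁻¹).toReal := by rw [hpq.scaling]; ring
  refine ⟨?_, hscal⟩
  have hq1 : 1 ≤ q := le_trans (by norm_num) hpq.two_le_right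
  have hp0 : p ≠ 0 := (lt_of_lt_of_le (by norm_num) hpq.two_le_left).ne'
  -- the dual exponent
  obtain ⟨r, hr⟩ : ∃ r : ℝ≥0∞, r.HolderConjugate q :=
    ⟨q.conjExponent, (ENNReal.HolderConjugate.conjExponent hq1).symm⟩
  have hrq : (r⁻¹).toReal = 1 - (q⁻¹).toReal := by
    have h := ENNReal.HolderConjugate.inv_add_inv_eq_one r q
    have h1 : r⁻¹ ≠ ∞ := ne_top_of_le_ne_top (by simp) (h ▸ le_self_add : r⁻¹ ≤ 1)
    have h2 : q⁻¹ ≠ ∞ := ne_top_of_le_ne_top (by simp) (h ▸ le_add_self : q⁻¹ ≤ 1)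
    have h3 := congrArg ENNReal.toReal h
    rw [ENNReal.toReal_add h1 h2] at h3
    simp only [ENNReal.toReal_one] at h3
    linarith
  -- `r = ∞` would mean `q = 1`, excluded by `2 ≤ q`; the scaling law for norms needs `r` finite.
  have hr' : r ≠ ∞ := by
    rintro rfl
    have h := ENNReal.HolderConjugate.inv_add_inv_eq_one ∞ q
    have : q = 1 := by simpa using h
    exact absurd hpq.two_le_right (by simp [this])
  obtain ⟨χ, f, hχ, hf, hf0⟩ :=
    exists_schwartz_annulus (e := (EuclideanSpace.single ⟨0, hd⟩ 2 : EuclideanSpace ℝ (Fin d)))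
      (by simp)
  obtain ⟨c, hc0, hc⟩ := exists_le_bessel_weight (d := d) k
  -- the time interval
  set T : ℝ := (‖P‖ + 1)⁻¹
  have hT : 0 < T := by positivity
  set J : Set ℝ := I ∩ Set.Icc (-T) T
  have hJ0 : volume J ≠ 0 := (volume_inter_Icc_pos hI h0 hIpos hT).ne'
  have hJtop : volume J ≠ ∞ :=
    ne_top_of_le_ne_top (by simp) (measure_mono Set.inter_subset_right)
  have hJm : MeasurableSet J := hI.measurableSet.inter measurableSet_Icc
  have hPt (t : ℝ) (ht : t ∈ J) : |t| * ‖P‖ ≤ 1 := by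
    have h1 : |t| ≤ T := abs_le.mpr ht.2
    calc |t| * ‖P‖ ≤ T * (‖P‖ + 1) := by gcongr; linarith
      _ = 1 := inv_mul_cancel₀ (by positivity)
  set m : ℝ := (volume J ^ (1 / p.toReal)).toReal
  have hmtop : volume J ^ (1 / p.toReal) ≠ ∞ :=
    ENNReal.rpow_ne_top_of_nonneg (by positivity) hJtop
  have hm : 0 < m := ENNReal.toReal_pos (by simp [hJ0, hJtop]) hmtop
  -- Adding 1 gives a positive divisor without showing that the norm is nonzero.
  set B : ℝ := (eLpNorm (𝓕 χ : 𝓢(EuclideanSpace ℝ (Fin d), ℂ)) r volume).toReal + 1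
  have hB : 0 < B := by positivity
  have hχB : eLpNorm (𝓕 χ : 𝓢(EuclideanSpace ℝ (Fin d), ℂ)) r volume ≤ ENNReal.ofReal B := by
    rw [← ENNReal.ofReal_toReal ((𝓕 χ : 𝓢(EuclideanSpace ℝ (Fin d), ℂ)).memLp r volume).eLpNorm_ne_top]
    exact ENNReal.ofReal_le_ofReal (by simp [B])
  set D : ℝ := (eLpNorm χ 2 volume).toReal
  suffices h : (d : ℝ) / 2 - d * (q⁻¹).toReal - k ≤ 0 by rw [hscal]; linarith
  refine exponent_le_zero_of_rpow_le (a := c / 2 * (∫ x, f x ^ 2) / B * m) (b := C * D)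
    (by positivity) fun l hl ↦ ?_
  have hl0 : 0 < l := by linarith
  obtain ⟨u, hu⟩ := exists_besselL2_eq k ((𝓕⁻ (dilate hl0 χ)).toLp 2)
  -- The exponent is `d - d/r = d/q`.
  have hφ : eLpNorm (𝓕 (dilate hl0 χ) : 𝓢(EuclideanSpace ℝ (Fin d), ℂ)) r volume ≤
      ENNReal.ofReal (l ^ (d * (q⁻¹).toReal) * B) := by
    have h1 : ⇑(𝓕 (dilate hl0 χ) : 𝓢(EuclideanSpace ℝ (Fin d), ℂ)) =
        ((l ^ d : ℝ) : ℂ) • fun x ↦ (𝓕 χ : 𝓢(EuclideanSpace ℝ (Fin d), ℂ)) (l • x) := by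
      ext x
      rw [fourier_dilate_apply, finrank_euclideanSpace_fin]
      rfl
    rw [h1, eLpNorm_const_smul, eLpNorm_comp_smul hl0 hr', finrank_euclideanSpace_fin,
      ← mul_assoc, ENNReal.ofReal_mul (by positivity)]
    gcongr
    rw [← ofReal_norm, ← ENNReal.ofReal_mul (norm_nonneg _), Complex.norm_real,
      Real.norm_of_nonneg (by positivity), ← Real.rpow_natCast, ← Real.rpow_add hl0, hrq]
    apply le_of_eq
    congr 2
    ring
  have hnorm : sobolevNorm u = l ^ ((d : ℝ) / 2) * D := by
    rw [sobolevNorm, hu, ← SchwartzMap.toLp_fourierInv_eq, ← Lp.norm_fourier_eq,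
      fourier_fourierInv_eq, SchwartzMap.norm_toLp]
    have h1 : ⇑(dilate hl0 χ) = fun x ↦ χ (l⁻¹ • x) := rfl
    rw [h1, eLpNorm_comp_smul (inv_pos.mpr hl0) (by simp), ENNReal.toReal_mul,
      ENNReal.toReal_ofReal (by positivity), finrank_euclideanSpace_fin, Real.inv_rpow hl0.le,
      ← Real.rpow_neg hl0.le]
    congr 2
    simp
    ring
  set b : ℝ := l ^ (d * (q⁻¹).toReal) * B
  have hb : 0 < b := by positivity
  set A : ℝ := c / 2 * (∫ x, f x ^ 2) * l ^ (d - k)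
  have hlow (t : ℝ) (ht : t ∈ J) : ENNReal.ofReal (A / b) ≤ lqNorm q (freeFlow P t u) := by
    have h1 := le_norm_freeFlow_fourier_dilate P (hPt t ht) k hχ hf hl0 (hc l hl) u hu
    refine le_trans ?_ (enorm_apply_div_le_lqNorm (freeFlow P t u) _ hφ (by simpa using hb)
      ENNReal.ofReal_ne_top)
    rw [ENNReal.ofReal_div_of_pos hb, ← ofReal_norm]
    gcongr
  have hfinal := (mul_measure_rpow_le_eLpNorm hp0 Set.inter_subset_left hJm hJ0 hlow).trans (hS u)
  rw [← ENNReal.ofReal_toReal hmtop, ← ENNReal.ofReal_mul (by positivity),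
    ENNReal.ofReal_le_ofReal_iff (by rw [hnorm]; positivity), hnorm] at hfinal
  have hl2 : 0 < l ^ ((d : ℝ) / 2) := by positivity
  refine le_of_mul_le_mul_right (le_trans (le_of_eq ?_) (hfinal.trans (le_of_eq ?_))) hl2
  · have h1 : l ^ ((d : ℝ) / 2 - d * (q⁻¹).toReal - k) * l ^ ((d : ℝ) / 2) * l ^ (d * (q⁻¹).toReal)
        = l ^ (d - k) := by
      rw [← Real.rpow_add hl0, ← Real.rpow_add hl0]
      congr 1
      ring
    simp only [A, b, m]
    rw [← h1]
    field_simp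
  · ring
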